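/- **Lemma (Assembled Gauss-Radau quadrature error on $I$).** Let $d\in\mathbb N$ and let $\Omega\subset\mathbb R^d$ be a bounded open set (for instance a bounded Lipschitz domain with $d\in\{2,3\}$). Let $T>0$, $I=(0,T)$, $k\in\mathbb N_0$, $1<p<2$, $\nu_\infty\ge 0$, $\nu>0$, $\delta>0$, and put $$\boldsymbol S(\boldsymbol A)=\bigl(\nu_\infty+\nu(\delta^2+|\boldsymbol A|^2)^{\frac{p-2}{2}}\bigr)\boldsymbol A,\qquad \boldsymbol D\boldsymbol v=\tfrac12(\nabla\boldsymbol v+(\nabla\boldsymbol v)^\top),$$ where $|\cdot|$ is the Frobenius norm. For every $A_k\ge 0$ there is a constant $B_k$, depending only on $A_k,p,\nu_\infty,\delta$ and on the fixed data $k,d,\Omega,T,\nu$, such that the following holds. Let $0=t_0<t_1<\dots<t_N=T$ be any partition, $I_n=(t_{n-1},t_n]$, $\tau_n=t_n-t_{n-1}$, $\tau=\max_n\tau_n$. Let $\boldsymbol V_h$ be any linear subspace of $H^1(\Omega)^d$ (for instance a conforming finite element space), and let $Y_\tau^k(I)\otimes\boldsymbol V_h$ be the space of functions of time which on each $I_n$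 are polynomials in $t$ of degree at most $k$ with coefficients in $\boldsymbol V_h$. Let $\boldsymbol v_{\tau h}\in Y_\tau^k(I)\otimes\boldsymbol V_h$ satisfy $$\max_{0\le\ell\le k}\ \max_{1\le n\le N}\ \|\partial_t^\ell\boldsymbol v_{\tau h}\|_{L^\infty(I_n;W^{1,\infty}(\Omega)^d)}\le A_k ,$$ let $\boldsymbol\varphi_{\tau h}\in Y_\tau^k(I)\otimes\boldsymbol V_h$ be arbitrary, and set $$\phi_{\mathrm{conv}}(t)=(\boldsymbol v_{\tau h}(t)\otimes\boldsymbol v_{\tau h}(t),\nabla\boldsymbol\varphi_{\tau h}(t))_{L^2(\Omega)},\qquad \phi_{\mathrm{visc}}(t)=(\boldsymbol S(\boldsymbol D\boldsymbol v_{\tau h}(t)),\boldsymbol D\boldsymbol\varphi_{\tau h}(t))_{L^2(\Omega)} .$$ Let $Q_n$ be the right-sided $(k+1)$-point Gauss-Radau rule on $I_n$, that is, the rule with $k+1$ nodes in $I_n$, one of them $t_n$, which is exact for polynomials of degree at most $2k$. Then $$\Bigl|\sum_{n=1}^N\Bigl(\int_{I_n}\phi_{\mathrm{conv}}\,dt-Q_n(\phi_{\mathrm{conv}})\Bigr)\Bigr|+\Bigl|\sum_{n=1}^N\Bigl(\int_{I_n}\phi_{\mathrm{visc}}\,dt-Q_n(\phi_{\mathrm{visc}})\Bigr)\Bigr|\le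 B_k\,\tau^{k+1}\,\|\boldsymbol\varphi_{\tau h}\|_{L^2(I;H^1(\Omega)^d)} .$$ In particular $B_k$ does not depend on the partition, on $\boldsymbol V_h$, on $\boldsymbol v_{\tau h}$ or on $\boldsymbol\varphi_{\tau h}$. -/

import Mathlib

open MeasureTheory Set
open scoped ENNReal NNReal ContDiff

/-! ### The right-sided Gauss-Radau rule -/

noncomputable section

/-- The right Radau polynomial of degree `k + 1` on `[0, 1]`,
`d^k/dx^k (x^k (x - 1)^(k + 1))`. -/
def radauPoly (k : ℕ) : Polynomial ℝ :=
  Polynomial.derivative^[k] (Polynomial.X ^ k * (Polynomial.X - Polynomial.C 1) ^ (k + 1))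

/-- The nodes of the right-sided `(k + 1)`-point Gauss-Radau rule on the unit interval. -/
def radauNodes (k : ℕ) : Finset ℝ := (radauPoly k).roots.toFinset

/-- The (interpolatory) weight of the node `c`. -/
def radauWeight (k : ℕ) (c : ℝ) : ℝ :=
  ∫ x in (0 : ℝ)..1, (Lagrange.basis (radauNodes k) id c).eval x

/-- The right-sided `(k + 1)`-point Gauss-Radau rule on `(a, b]`, applied to `f`. -/
def radauQuad (k : ℕ) (a b : ℝ) (f : ℝ → ℝ) : ℝ :=
  (b - a) * ∑ c ∈ radauNodes k, radauWeight k c * f (a + (b - a) * c)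

/-! The next facts confirm that this is the `(k + 1)`-point rule which has the right end point as
a node, has all its nodes in `(0, 1]`, and is exact for polynomials of degree at most `2 k`. -/

theorem radau_eval_zero (k m : ℕ) (hm : m < k) :
    (Polynomial.derivative^[m] (Polynomial.X ^ k *
      (Polynomial.X - Polynomial.C (1 : ℝ)) ^ (k + 1))).eval 0 = 0 := by
  have h : (Polynomial.X : Polynomial ℝ) ^ (k - m) ∣ Polynomial.derivative^[m] (Polynomial.X ^ k *
      (Polynomial.X - Polynomial.C (1 : ℝ)) ^ (k + 1)) :=
    Polynomial.pow_sub_dvd_iterate_derivative_of_pow_dvd m (Dvd.intro _ rfl)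
  have h2 := (dvd_pow_self (Polynomial.X : Polynomial ℝ) (by omega : k - m ≠ 0)).trans h
  obtain ⟨q, hq⟩ := h2
  rw [hq]; simp

theorem radau_eval_one (k m : ℕ) (hm : m ≤ k) :
    (Polynomial.derivative^[m] (Polynomial.X ^ k *
      (Polynomial.X - Polynomial.C (1 : ℝ)) ^ (k + 1))).eval 1 = 0 := by
  have h : (Polynomial.X - Polynomial.C (1 : ℝ)) ^ (k + 1 - m) ∣
      Polynomial.derivative^[m] (Polynomial.X ^ k *
      (Polynomial.X - Polynomial.C (1 : ℝ)) ^ (k + 1)) :=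
    Polynomial.pow_sub_dvd_iterate_derivative_of_pow_dvd m (Dvd.intro_left _ rfl)
  have h2 := (dvd_pow_self (Polynomial.X - Polynomial.C (1 : ℝ))
    (by omega : k + 1 - m ≠ 0)).trans h
  obtain ⟨q, hq⟩ := h2
  rw [hq]; simp

theorem radau_base_natDegree (k : ℕ) :
    (Polynomial.X ^ k * (Polynomial.X - Polynomial.C (1 : ℝ)) ^ (k + 1)).natDegree = 2 * k + 1 := by
  rw [Polynomial.Monic.natDegree_mul (Polynomial.monic_X_pow k)
    ((Polynomial.monic_X_sub_C (1 : ℝ)).pow _)]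
  rw [Polynomial.natDegree_X_pow, Polynomial.natDegree_pow, Polynomial.natDegree_X_sub_C]
  omega

theorem radau_iterate_natDegree (k m : ℕ) (hm : m ≤ k) :
    (Polynomial.derivative^[m] (Polynomial.X ^ k *
      (Polynomial.X - Polynomial.C (1 : ℝ)) ^ (k + 1))).natDegree = 2 * k + 1 - m := by
  induction m with
  | zero => simpa using radau_base_natDegree k
  | succ m ih =>
    rw [Function.iterate_succ_apply', Polynomial.natDegree_derivative, ih (by omega)]
    omega

theorem radau_iterate_ne_zero (k m : ℕ) (hm : m ≤ k) :
    Polynomial.derivative^[m] (Polynomial.X ^ k *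
      (Polynomial.X - Polynomial.C (1 : ℝ)) ^ (k + 1)) ≠ 0 := by
  intro h
  have := radau_iterate_natDegree k m hm
  rw [h, Polynomial.natDegree_zero] at this
  omega

theorem radau_card_lower (k m : ℕ) (hm : m < k) :
    m + 2 ≤ (Polynomial.derivative^[m] (Polynomial.X ^ k *
      (Polynomial.X - Polynomial.C (1 : ℝ)) ^ (k + 1))).roots.toFinset.card := by
  have sub : ∀ m, m < k → ({0, 1} : Finset ℝ) ⊆ (Polynomial.derivative^[m] (Polynomial.X ^ k *
      (Polynomial.X - Polynomial.C (1 : ℝ)) ^ (k + 1))).roots.toFinset := by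
    intro m hm x hx
    rw [Multiset.mem_toFinset, Polynomial.mem_roots (radau_iterate_ne_zero k m hm.le)]
    rcases Finset.mem_insert.1 hx with rfl | hx
    · exact radau_eval_zero k m hm
    · rw [Finset.mem_singleton.1 hx]; exact radau_eval_one k m hm.le
  induction m with
  | zero =>
    refine le_trans ?_ (Finset.card_le_card (sub 0 hm))
    simp
  | succ m ih =>
    have h1 := ih (by omega)
    have h2 := Polynomial.card_roots_toFinset_le_card_roots_derivative_sdiff_roots_succ
      (Polynomial.derivative^[m] (Polynomial.X ^ k *
        (Polynomial.X - Polynomial.C (1 : ℝ)) ^ (k + 1)))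
    rw [← Function.iterate_succ_apply' Polynomial.derivative] at h2
    have s1 := sub m (by omega)
    have s2 := sub (m + 1) hm
    generalize (Polynomial.derivative^[m] (Polynomial.X ^ k *
        (Polynomial.X - Polynomial.C (1 : ℝ)) ^ (k + 1))).roots.toFinset = U at *
    generalize (Polynomial.derivative^[m + 1] (Polynomial.X ^ k *
        (Polynomial.X - Polynomial.C (1 : ℝ)) ^ (k + 1))).roots.toFinset = W at *
    have h3 : ({0, 1} : Finset ℝ) ∪ (W \ U) ⊆ W :=
      Finset.union_subset s2 Finset.sdiff_subset
    have h4 := Finset.card_le_card h3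
    rw [Finset.card_union_of_disjoint] at h4
    · have : ({0, 1} : Finset ℝ).card = 2 := by simp
      omega
    · exact Finset.disjoint_of_subset_left s1 Finset.disjoint_sdiff

theorem one_mem_radauNodes (k : ℕ) : (1 : ℝ) ∈ radauNodes k := by
  rw [radauNodes, radauPoly, Multiset.mem_toFinset,
    Polynomial.mem_roots (radau_iterate_ne_zero k k le_rfl)]
  exact radau_eval_one k k le_rfl

theorem card_radauNodes (k : ℕ) : (radauNodes k).card = k + 1 := by
  apply le_antisymm
  · refine (Multiset.toFinset_card_le _).trans ((Polynomial.card_roots' _).trans ?_)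
    rw [radauPoly, radau_iterate_natDegree k k le_rfl]
    omega
  · rcases k with _ | k
    · exact Finset.card_pos.2 ⟨1, one_mem_radauNodes 0⟩
    · have h1 := radau_card_lower (k + 1) k (by omega)
      have h2 := Polynomial.card_roots_toFinset_le_card_roots_derivative_sdiff_roots_succ
        (Polynomial.derivative^[k] (Polynomial.X ^ (k + 1) *
          (Polynomial.X - Polynomial.C (1 : ℝ)) ^ (k + 1 + 1)))
      rw [← Function.iterate_succ_apply' Polynomial.derivative] at h2
      have s1 : (1 : ℝ) ∈ (Polynomial.derivative^[k] (Polynomial.X ^ (k + 1) *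
          (Polynomial.X - Polynomial.C (1 : ℝ)) ^ (k + 1 + 1))).roots.toFinset := by
        rw [Multiset.mem_toFinset, Polynomial.mem_roots
          (radau_iterate_ne_zero (k + 1) k (by omega))]
        exact radau_eval_one (k + 1) k (by omega)
      have s2 := one_mem_radauNodes (k + 1)
      change _ ≤ (radauNodes (k + 1) \ _).card + 1 at h2
      generalize (Polynomial.derivative^[k] (Polynomial.X ^ (k + 1) *
          (Polynomial.X - Polynomial.C (1 : ℝ)) ^ (k + 1 + 1))).roots.toFinset = U at *
      generalize radauNodes (k + 1) = W at *
      have h3 : insert (1 : ℝ) (W \ U) ⊆ W :=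
        Finset.insert_subset s2 Finset.sdiff_subset
      have h4 := Finset.card_le_card h3
      rw [Finset.card_insert_of_notMem (by simp [s1])] at h4
      omega

theorem intervalIntegrable_eval_mul (p q : Polynomial ℝ) (a b : ℝ) :
    IntervalIntegrable (fun x => p.eval x * q.eval x) volume a b :=
  (p.continuous.mul q.continuous).intervalIntegrable _ _

theorem radau_orthogonal (k m : ℕ) (hm : m ≤ k) (q : Polynomial ℝ) (hq : q.degree < m) :
    ∫ x in (0 : ℝ)..1, (Polynomial.derivative^[m] (Polynomial.X ^ k *
      (Polynomial.X - Polynomial.C (1 : ℝ)) ^ (k + 1))).eval x * q.eval x = 0 := by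
  induction m generalizing q with
  | zero =>
    have : q = 0 := by
      rw [← Polynomial.degree_eq_bot]; simpa using hq
    simp [this]
  | succ m ih =>
    have hP := intervalIntegral.integral_deriv_mul_eq_sub_of_hasDerivAt (a := (0 : ℝ)) (b := 1)
      (u := fun x => (Polynomial.derivative^[m] (Polynomial.X ^ k *
        (Polynomial.X - Polynomial.C (1 : ℝ)) ^ (k + 1))).eval x)
      (v := fun x => q.eval x) (Polynomial.continuous _).continuousOn
      (Polynomial.continuous _).continuousOn
      (fun x _ => Polynomial.hasDerivAt _ x) (fun x _ => Polynomial.hasDerivAt _ x)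
      ((Polynomial.continuous _).intervalIntegrable _ _)
      ((Polynomial.continuous _).intervalIntegrable _ _)
    rw [intervalIntegral.integral_add (intervalIntegrable_eval_mul _ _ _ _)
      (intervalIntegrable_eval_mul _ _ _ _),
      radau_eval_zero k m (by omega), radau_eval_one k m (by omega)] at hP
    have hz : ∫ x in (0 : ℝ)..1, (Polynomial.derivative^[m] (Polynomial.X ^ k *
        (Polynomial.X - Polynomial.C (1 : ℝ)) ^ (k + 1))).eval x *
          (Polynomial.derivative q).eval x = 0 := by
      by_cases h0 : q = 0
      · simp [h0]
      · refine ih (by omega) _ ?_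
        have h1 := Polynomial.degree_derivative_lt h0
        have h2 : q.degree ≤ m := by
          rw [Polynomial.degree_eq_natDegree h0] at hq ⊢
          have hq' : q.natDegree < m + 1 := by exact_mod_cast hq
          exact_mod_cast Nat.lt_succ_iff.1 hq'
        exact h1.trans_le h2
    rw [Function.iterate_succ_apply']
    linarith

/-- Exactness for polynomials of degree at most `2 k`. -/
theorem radau_exact (k : ℕ) (f : Polynomial ℝ) (hf : f.natDegree ≤ 2 * k) :
    ∑ c ∈ radauNodes k, radauWeight k c * f.eval c = ∫ x in (0 : ℝ)..1, f.eval x := by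
  have hn0 : radauPoly k ≠ 0 := radau_iterate_ne_zero k k le_rfl
  have hnd : (radauPoly k).natDegree = k + 1 := by
    rw [radauPoly, radau_iterate_natDegree k k le_rfl]; omega
  have hdiv := EuclideanDomain.div_add_mod f (radauPoly k)
  set q := f / radauPoly k with hq
  set r := f % radauPoly k with hr
  have hrd : r.degree < (radauNodes k).card := by
    rw [card_radauNodes]
    have := EuclideanDomain.mod_lt f hn0
    have h2 : r.degree < (radauPoly k).degree := this
    rw [Polynomial.degree_eq_natDegree hn0, hnd] at h2
    exact h2
  have hqd : q.degree < k := by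
    by_cases h0 : q = 0
    · rw [h0, Polynomial.degree_zero]; exact WithBot.bot_lt_coe _
    · have hle : (radauPoly k).degree ≤ f.degree := by
        by_contra hlt
        exact h0 ((Polynomial.div_eq_zero_iff hn0).2 (not_le.1 hlt))
      have hadd := Polynomial.degree_add_div hn0 hle
      have hf0 : f ≠ 0 := by
        rintro rfl
        exact h0 (by rw [hq, EuclideanDomain.zero_div])
      rw [← hq, Polynomial.degree_eq_natDegree hn0, Polynomial.degree_eq_natDegree h0,
        Polynomial.degree_eq_natDegree hf0, hnd] at hadd
      have hadd' : (k + 1) + q.natDegree = f.natDegree := by exact_mod_cast hadd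
      rw [Polynomial.degree_eq_natDegree h0]
      exact_mod_cast (by omega : q.natDegree < k)
  have hint : ∫ x in (0 : ℝ)..1, f.eval x = ∫ x in (0 : ℝ)..1, r.eval x := by
    have horth := radau_orthogonal k k le_rfl q hqd
    rw [← hdiv]
    simp only [Polynomial.eval_add, Polynomial.eval_mul]
    rw [intervalIntegral.integral_add (intervalIntegrable_eval_mul _ _ _ _)
      ((Polynomial.continuous _).intervalIntegrable _ _)]
    change (∫ x in (0 : ℝ)..1, (radauPoly k).eval x * q.eval x) = 0 at horth
    rw [horth, zero_add]
  have hval : ∀ c ∈ radauNodes k, f.eval c = r.eval c := by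
    intro c hc
    rw [radauNodes, Multiset.mem_toFinset, Polynomial.mem_roots hn0] at hc
    rw [← hdiv, Polynomial.eval_add, Polynomial.eval_mul, hc.eq_zero]
    ring
  rw [hint, Finset.sum_congr rfl fun c hc => by rw [hval c hc]]
  have hL := Lagrange.eq_interpolate (s := radauNodes k) (v := id) (f := r)
    Function.injective_id.injOn hrd
  have hev : ∀ x : ℝ, r.eval x = ∑ c ∈ radauNodes k,
      (Lagrange.basis (radauNodes k) id c).eval x * r.eval c := by
    intro x
    conv_lhs => rw [hL]
    rw [Lagrange.interpolate_apply, Polynomial.eval_finsetSum]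
    refine Finset.sum_congr rfl fun c _ => ?_
    rw [Polynomial.eval_mul, Polynomial.eval_C, mul_comm]
    rfl
  rw [intervalIntegral.integral_congr (fun x _ => hev x), intervalIntegral.integral_finsetSum]
  · refine Finset.sum_congr rfl fun c _ => ?_
    rw [intervalIntegral.integral_mul_const, radauWeight]
  · intro c _
    exact ((Polynomial.continuous _).mul continuous_const).intervalIntegrable _ _

theorem radauNodes_subset (k : ℕ) {c : ℝ} (hc : c ∈ radauNodes k) : 0 < c ∧ c ≤ 1 := by
  by_cases hc1 : c = 1
  · rw [hc1]; norm_num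
  by_contra hcon
  have hout : c ≤ 0 ∨ 1 < c := by
    by_contra! h; exact hcon ⟨h.1, h.2⟩
  set s := ((radauNodes k).erase 1).erase c with hs
  have h1c : c ∈ (radauNodes k).erase 1 := Finset.mem_erase.2 ⟨hc1, hc⟩
  have hcard : s.card + 2 = k + 1 := by
    rw [← card_radauNodes k, ← Finset.card_erase_add_one (one_mem_radauNodes k),
      ← Finset.card_erase_add_one h1c]
  set g : Polynomial ℝ := (∏ a ∈ s, (Polynomial.X - Polynomial.C a)) with hg
  have hgd : g.natDegree = s.card := by
    rw [hg, Polynomial.natDegree_prod_of_monic _ _ fun a _ => Polynomial.monic_X_sub_C a]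
    simp
  set f : Polynomial ℝ := (Polynomial.X - Polynomial.C 1) * (Polynomial.X - Polynomial.C c) *
    g ^ 2 with hf
  have hfd : f.natDegree ≤ 2 * k := by
    refine Polynomial.natDegree_mul_le.trans ?_
    have a1 := Polynomial.natDegree_mul_le (p := Polynomial.X - Polynomial.C (1 : ℝ))
      (q := Polynomial.X - Polynomial.C c)
    have a2 := Polynomial.natDegree_pow_le (p := g) (n := 2)
    simp only [Polynomial.natDegree_X_sub_C] at a1
    omega
  have hex := radau_exact k f hfd
  have hzero : ∑ a ∈ radauNodes k, radauWeight k a * f.eval a = 0 := by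
    refine Finset.sum_eq_zero fun a ha => ?_
    suffices f.eval a = 0 by rw [this, mul_zero]
    by_cases e1 : a = 1
    · simp [hf, e1]
    by_cases e2 : a = c
    · simp [hf, e2]
    have ha' : a ∈ s := Finset.mem_erase.2 ⟨e2, Finset.mem_erase.2 ⟨e1, ha⟩⟩
    have : g.eval a = 0 := by
      rw [hg, Polynomial.eval_prod]
      exact Finset.prod_eq_zero ha' (by simp)
    simp [hf, this]
  have hne : f ≠ 0 := by
    have : g ≠ 0 := (Polynomial.monic_prod_of_monic _ _
      fun a _ => Polynomial.monic_X_sub_C a).ne_zero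
    exact mul_ne_zero (mul_ne_zero (Polynomial.X_sub_C_ne_zero _) (Polynomial.X_sub_C_ne_zero _))
      (pow_ne_zero _ this)
  -- the sign of `f` on `[0, 1]` is constant
  have key : ∀ F : Polynomial ℝ, F ≠ 0 → (∀ x ∈ Icc (0 : ℝ) 1, 0 ≤ F.eval x) →
      ∫ x in (0 : ℝ)..1, F.eval x ≠ 0 := by
    intro F hF hpos hzero
    have hfin : (Icc (0 : ℝ) 1 \ {x | F.IsRoot x}).Nonempty := by
      refine ((Icc_infinite (by norm_num : (0 : ℝ) < 1)).sdiff ?_).nonempty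
      exact Polynomial.finite_setOfPred_isRoot hF
    obtain ⟨x, hx, hxr⟩ := hfin
    have hlt : 0 < F.eval x := lt_of_le_of_ne (hpos x hx) (fun h => hxr h.symm)
    have := intervalIntegral.integral_pos (a := (0 : ℝ)) (b := 1) (by norm_num)
      (f := fun x => F.eval x) F.continuous.continuousOn
      (fun y hy => hpos y ⟨hy.1.le, hy.2⟩) ⟨x, hx, hlt⟩
    exact absurd hzero this.ne'
  rw [hzero] at hex
  have hev : ∀ x, f.eval x = (x - 1) * (x - c) * (g.eval x) ^ 2 := by
    intro x; simp [hf]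
  rcases hout with h | h
  · refine key (-f) (neg_ne_zero.2 hne) (fun x hx => ?_) ?_
    · rw [Polynomial.eval_neg, hev]
      nlinarith [mul_nonneg (mul_nonneg (sub_nonneg.2 hx.2) (by linarith [hx.1] : 0 ≤ x - c))
        (sq_nonneg (g.eval x))]
    · simp only [Polynomial.eval_neg]
      rw [intervalIntegral.integral_neg, ← hex, neg_zero]
  · refine key f hne (fun x hx => ?_) hex.symm
    rw [hev]
    exact mul_nonneg (mul_nonneg_of_nonpos_of_nonpos (by linarith [hx.2]) (by linarith [hx.2]))
      (sq_nonneg _)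

/-! ### The Sobolev space of velocities -/

/-- Vectors of `ℝ^d`, with the Euclidean norm. -/
abbrev Vec (d : ℕ) : Type := EuclideanSpace ℝ (Fin d)

/-- Real `d × d` matrices, with the Frobenius inner product `A : B` and the Frobenius norm. -/
abbrev Mat (d : ℕ) : Type := EuclideanSpace ℝ (Fin d × Fin d)

/-- `a ⊗ b`, with entries `a i * b j`. -/
def outer {d : ℕ} (a b : Vec d) : Mat d := WithLp.toLp 2 fun ij => a ij.1 * b ij.2

/-- The symmetric part `(A + Aᵀ) / 2`. -/
def symPart {d : ℕ} (A : Mat d) : Mat d := WithLp.toLp 2 fun ij => (A ij + A ij.swap) / 2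

/-- `G` is the weak gradient of the vector field `u` in `Ω`: `G i j = ∂_j u_i`. -/
def IsWeakGradient {d : ℕ} (Ω : Set (Vec d)) (u : Vec d → Vec d) (G : Vec d → Mat d) : Prop :=
  ∀ φ : Vec d → ℝ, ContDiff ℝ ∞ φ → HasCompactSupport φ → tsupport φ ⊆ Ω → ∀ i j : Fin d,
    ∫ x in Ω, u x i * fderiv ℝ φ x (EuclideanSpace.single j 1) = -∫ x in Ω, G x (i, j) * φ x

theorem integrable_coord_mul {ι X : Type*} [Fintype ι] [MeasurableSpace X] [TopologicalSpace X]
    [OpensMeasurableSpace X] {μ : Measure X} [IsFiniteMeasureOnCompacts μ]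
    (u : Lp (EuclideanSpace ℝ ι) 2 μ) (i : ι) {g : X → ℝ} (hg : Continuous g)
    (hc : HasCompactSupport g) : Integrable (fun x => u x i * g x) μ := by
  have h1 : MemLp (fun x => u x i) 2 μ :=
    (EuclideanSpace.proj (𝕜 := ℝ) i).comp_memLp' (Lp.memLp u)
  have h2 : MemLp g 2 μ := hg.memLp_of_hasCompactSupport hc
  exact h1.integrable_mul h2

/-- `H¹(Ω)^d`: the pairs `(u, ∇u)` in `L² × L²` whose second component is the weak gradient of the
first. The norm inherited from the `ℓ²` product is `(‖u‖² + ‖∇u‖²) ^ (1 / 2)`. -/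
def SobolevH1 {d : ℕ} (Ω : Set (Vec d)) : Submodule ℝ (WithLp 2
    (Lp (Vec d) 2 (volume.restrict Ω) × Lp (Mat d) 2 (volume.restrict Ω))) where
  carrier := {z | IsWeakGradient Ω z.fst z.snd}
  zero_mem' := by
    intro φ _ _ _ i j
    have h1 := Lp.coeFn_zero (Vec d) 2 (volume.restrict Ω)
    have h2 := Lp.coeFn_zero (Mat d) 2 (volume.restrict Ω)
    rw [integral_eq_zero_of_ae, integral_eq_zero_of_ae, neg_zero]
    · filter_upwards [h2] with x hx
      have hx' : (0 : WithLp 2 (Lp (Vec d) 2 (volume.restrict Ω) ×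
        Lp (Mat d) 2 (volume.restrict Ω))).snd x = 0 := hx
      simp only [hx', PiLp.zero_apply, zero_mul, Pi.zero_apply]
    · filter_upwards [h1] with x hx
      have hx' : (0 : WithLp 2 (Lp (Vec d) 2 (volume.restrict Ω) ×
        Lp (Mat d) 2 (volume.restrict Ω))).fst x = 0 := hx
      simp only [hx', PiLp.zero_apply, zero_mul, Pi.zero_apply]
  add_mem' := by
    intro y z hy hz φ hφ hc hs i j
    have hd : Continuous fun x => fderiv ℝ φ x (EuclideanSpace.single j 1) :=
      (hφ.continuous_fderiv (by simp)).clm_apply continuous_const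
    have hdc : HasCompactSupport fun x => fderiv ℝ φ x (EuclideanSpace.single j 1) :=
      hc.fderiv_apply ℝ _
    have h1 : (fun x => (y + z).fst x i * fderiv ℝ φ x (EuclideanSpace.single j 1))
        =ᵐ[volume.restrict Ω] fun x => y.fst x i * fderiv ℝ φ x (EuclideanSpace.single j 1) +
          z.fst x i * fderiv ℝ φ x (EuclideanSpace.single j 1) := by
      filter_upwards [Lp.coeFn_add y.fst z.fst] with x hx
      have hx' : (y + z).fst x = y.fst x + z.fst x := hx
      simp only [hx', PiLp.add_apply, add_mul]
    have h2 : (fun x => (y + z).snd x (i, j) * φ x) =ᵐ[volume.restrict Ω]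
        fun x => y.snd x (i, j) * φ x + z.snd x (i, j) * φ x := by
      filter_upwards [Lp.coeFn_add y.snd z.snd] with x hx
      have hx' : (y + z).snd x = y.snd x + z.snd x := hx
      simp only [hx', PiLp.add_apply, add_mul]
    rw [integral_congr_ae h1, integral_congr_ae h2,
      integral_add (integrable_coord_mul _ _ hd hdc) (integrable_coord_mul _ _ hd hdc),
      integral_add (integrable_coord_mul _ _ hφ.continuous hc)
        (integrable_coord_mul _ _ hφ.continuous hc),
      hy φ hφ hc hs i j, hz φ hφ hc hs i j, neg_add]
  smul_mem' := by
    intro r z hz φ hφ hc hs i j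
    have h1 : (fun x => (r • z).fst x i * fderiv ℝ φ x (EuclideanSpace.single j 1))
        =ᵐ[volume.restrict Ω]
          fun x => r * (z.fst x i * fderiv ℝ φ x (EuclideanSpace.single j 1)) := by
      filter_upwards [Lp.coeFn_smul r z.fst] with x hx
      have hx' : (r • z).fst x = r • z.fst x := hx
      simp only [hx', PiLp.smul_apply, smul_eq_mul, mul_assoc]
    have h2 : (fun x => (r • z).snd x (i, j) * φ x) =ᵐ[volume.restrict Ω]
        fun x => r * (z.snd x (i, j) * φ x) := by
      filter_upwards [Lp.coeFn_smul r z.snd] with x hx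
      have hx' : (r • z).snd x = r • z.snd x := hx
      simp only [hx', PiLp.smul_apply, smul_eq_mul, mul_assoc]
    rw [integral_congr_ae h1, integral_congr_ae h2, integral_const_mul, integral_const_mul,
      hz φ hφ hc hs i j, mul_neg]

/-- The field itself. -/
def field {d : ℕ} {Ω : Set (Vec d)} (u : SobolevH1 Ω) : Lp (Vec d) 2 (volume.restrict Ω) :=
  u.1.fst

/-- Its weak gradient. -/
def weakGrad {d : ℕ} {Ω : Set (Vec d)} (u : SobolevH1 Ω) : Lp (Mat d) 2 (volume.restrict Ω) :=
  u.1.snd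

/-- The `W^{1,∞}(Ω)` norm, equal to `∞` if the field is not in `W^{1,∞}(Ω)`. -/
def w1inftyNorm {d : ℕ} {Ω : Set (Vec d)} (u : SobolevH1 Ω) : ℝ≥0∞ :=
  max (eLpNorm (field u) ∞ (volume.restrict Ω)) (eLpNorm (weakGrad u) ∞ (volume.restrict Ω))

/-! ### Stress law and spatial forms -/

/-- The regularized `(p, δ)` stress law
`S(A) = (ν∞ + ν (δ² + |A|²) ^ ((p - 2) / 2)) A`. -/
def stress {d : ℕ} (p νinf ν δ : ℝ) (A : Mat d) : Mat d :=
  (νinf + ν * (δ ^ 2 + ‖A‖ ^ 2) ^ ((p - 2) / 2)) • A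

/-- `(v ⊗ v, ∇w)_{L²(Ω)}`. -/
def convForm {d : ℕ} {Ω : Set (Vec d)} (v w : SobolevH1 Ω) : ℝ :=
  ∫ x in Ω, inner ℝ (outer (field v x) (field v x)) (weakGrad w x)

/-- `(S(Dv), Dw)_{L²(Ω)}`, where `D` is the symmetric gradient. -/
def viscForm {d : ℕ} {Ω : Set (Vec d)} (p νinf ν δ : ℝ) (v w : SobolevH1 Ω) : ℝ :=
  ∫ x in Ω, inner ℝ (stress p νinf ν δ (symPart (weakGrad v x))) (symPart (weakGrad w x))

/-! ### Time meshes and discontinuous-in-time polynomials -/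

/-- A partition `0 = t_0 < t_1 < … < t_N = T`. -/
structure TimeMesh (T : ℝ) where
  N : ℕ
  t : Fin (N + 1) → ℝ
  strictMono : StrictMono t
  first : t 0 = 0
  last : t (Fin.last N) = T

namespace TimeMesh

/-- Left end point of the `n`-th interval (counted from `n = 0`). -/
def left {T : ℝ} (M : TimeMesh T) (n : Fin M.N) : ℝ := M.t n.castSucc

/-- Right end point of the `n`-th interval. -/
def right {T : ℝ} (M : TimeMesh T) (n : Fin M.N) : ℝ := M.t n.succ

/-- The `n`-th interval, open on the left and closed on the right. -/
def slab {T : ℝ} (M : TimeMesh T) (n : Fin M.N) : Set ℝ := Ioc (M.left n) (M.right n)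

/-- The largest step size. -/
def stepSize {T : ℝ} (M : TimeMesh T) : ℝ := ⨆ n : Fin M.N, (M.right n - M.left n)

/-- `v` belongs to `Y_τ^k ⊗ V`: on each time interval it is a polynomial in time of degree at most
`k` with coefficients in `V`, with no continuity required across the intervals. The values outside
`(0, T]` are irrelevant. -/
def IsPiecewisePoly {T : ℝ} (M : TimeMesh T) {E : Type*} [AddCommGroup E] [Module ℝ E] (k : ℕ)
    (V : Submodule ℝ E) (v : ℝ → E) : Prop :=
  ∀ n : Fin M.N, ∃ c : Fin (k + 1) → V, ∀ t ∈ M.slab n, v t = ∑ j : Fin (k + 1), t ^ (j : ℕ) • (c j : E)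

/-- `‖∂_t^ℓ v‖` in `L^∞(I_n; W^{1,∞}(Ω))`, where `I_n` is the `n`-th time interval. -/
def slabNorm {T : ℝ} (M : TimeMesh T) {d : ℕ} {Ω : Set (Vec d)} (v : ℝ → SobolevH1 Ω) (l : ℕ)
    (n : Fin M.N) : ℝ≥0∞ :=
  essSup (fun t => w1inftyNorm (iteratedDerivWithin l v (M.slab n) t))
    (volume.restrict (M.slab n))

/-- The quadrature defect `∫_{I_n} φ(t) dt - Q_n(φ)` of the right-sided `(k + 1)`-point
Gauss-Radau rule on the `n`-th interval. -/
def radauDefect {T : ℝ} (M : TimeMesh T) (k : ℕ) (φ : ℝ → ℝ) (n : Fin M.N) : ℝ :=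
  (∫ t in M.left n..M.right n, φ t) - radauQuad k (M.left n) (M.right n) φ

end TimeMesh

end

/-! ### Interpolation in the Radau nodes -/

/-! On each interval both integrands have the form `⟪F t, g t⟫` in `L²(Ω)`. Here `g` is the weak
gradient of the test function, a polynomial of degree at most `k` in time, and `F t = Φ (u t)` for a
smooth map `Φ` of finite-dimensional spaces. For the convective form `u` is the velocity and `Φ y =
y ⊗ y`; for the viscous form `u` is its gradient and `Φ` is the stress law between two
symmetrizations, smooth because `δ > 0`.

Replace `F` by its interpolant in the Radau nodes. Its product with `g` has degree at most `2 k`, so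
the rule integrates it exactly, and the rule cannot tell it from `⟪F, g⟫`, since the two agree at
the nodes. The defect is therefore `∫ ⟪F - interpolant, g⟫` (`integral_inner_radauInterp`,
`abs_integral_sub_radauQuad_le`). No time derivative falls on the test function, so no inverse
estimate is needed and the full order `k + 1` comes from `F`.

The interpolation error is estimated for fixed `x`. The curve `t ↦ u t x` is a polynomial whose
derivatives up to order `k` are bounded by `A` and whose derivative of order `k + 1` vanishes; the
bound for derivatives of compositions then controls `Φ (u t x)` up to order `k + 1`
(`exists_bound_iteratedDeriv_comp`). Taylor's formula and the Lebesgue constant of the nodes give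
the rate `(b - a) ^ (k + 1)`, uniformly in `x`, hence in `L²` because `Ω` has finite measure
(`exists_superposition`). Summing over the intervals leaves the `L¹`-in-time norm of the test
function, which Cauchy-Schwarz turns into the `L²` norm. -/

/-- The interpolant of `F` in the Radau nodes of the interval `(a, b]`. -/
noncomputable def radauInterp {E : Type*} [AddCommGroup E] [Module ℝ E] (k : ℕ) (a b : ℝ)
    (F : ℝ → E) (t : ℝ) : E :=
  ∑ c ∈ radauNodes k,
    (Lagrange.basis (radauNodes k) id c).eval ((t - a) / (b - a)) • F (a + (b - a) * c)

theorem radauNode_mem_Ioc {k : ℕ} {a b c : ℝ} (hab : a < b) (hc : c ∈ radauNodes k) :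
    a + (b - a) * c ∈ Ioc a b := by
  obtain ⟨h0, h1⟩ := radauNodes_subset k hc
  have := sub_pos.2 hab
  constructor <;> nlinarith [mul_pos this h0]

/-- There are `k + 1` nodes, so a monomial of degree at most `k` is its own interpolant. -/
theorem sum_radauBasis_mul_pow {k i : ℕ} (hi : i ≤ k) (s : ℝ) :
    ∑ c ∈ radauNodes k, (Lagrange.basis (radauNodes k) id c).eval s * c ^ i = s ^ i := by
  have h := Lagrange.eq_interpolate (s := radauNodes k) (v := id) (f := Polynomial.X ^ i)
    Function.injective_id.injOn (by
      rw [Polynomial.degree_X_pow, card_radauNodes]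
      exact_mod_cast Nat.lt_succ_of_le hi)
  have h2 := congrArg (Polynomial.eval s) h
  rw [Lagrange.interpolate_apply, Polynomial.eval_finsetSum] at h2
  simp only [Polynomial.eval_mul, Polynomial.eval_C, Polynomial.eval_pow, Polynomial.eval_X,
    id] at h2
  rw [h2]
  exact Finset.sum_congr rfl fun c _ => mul_comm _ _

theorem radauInterp_node {E : Type*} [AddCommGroup E] [Module ℝ E] {k : ℕ} {a b c : ℝ}
    (hab : a < b) (F : ℝ → E) (hc : c ∈ radauNodes k) :
    radauInterp k a b F (a + (b - a) * c) = F (a + (b - a) * c) := by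
  have hs : (a + (b - a) * c - a) / (b - a) = c := by
    field_simp [(sub_pos.2 hab).ne']; ring
  rw [radauInterp, hs, Finset.sum_eq_single_of_mem c hc]
  · have := Lagrange.eval_basis_self (s := radauNodes k) (v := (id : ℝ → ℝ))
      Function.injective_id.injOn hc
    rw [id] at this
    rw [this, one_smul]
  · intro e _ hec
    have := Lagrange.eval_basis_of_ne (v := (id : ℝ → ℝ)) hec hc
    rw [id] at this
    rw [this, zero_smul]

theorem continuous_radauInterp {E : Type*} [NormedAddCommGroup E] [NormedSpace ℝ E] (k : ℕ)
    (a b : ℝ) (F : ℝ → E) : Continuous (radauInterp k a b F) := by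
  unfold radauInterp
  refine continuous_finsetSum _ fun c _ => Continuous.smul ?_ continuous_const
  exact (Polynomial.continuous _).comp ((continuous_id.sub continuous_const).div_const _)

/-- Polynomials of degree at most `k` are reproduced by the interpolation. -/
theorem radauInterp_shifted_poly {E : Type*} [AddCommGroup E] [Module ℝ E] {k : ℕ} {a b : ℝ}
    (hab : a < b) (e : ℕ → E) (t : ℝ) :
    radauInterp k a b (fun t => ∑ i ∈ Finset.range (k + 1), (t - a) ^ i • e i) t =
      ∑ i ∈ Finset.range (k + 1), (t - a) ^ i • e i := by
  simp only [radauInterp, Finset.smul_sum]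
  rw [Finset.sum_comm]
  refine Finset.sum_congr rfl fun i hi => ?_
  simp only [smul_smul, ← Finset.sum_smul]
  congr 1
  have h := sum_radauBasis_mul_pow (Nat.lt_succ_iff.1 (Finset.mem_range.1 hi)) ((t - a) / (b - a))
  rw [div_pow, eq_div_iff (pow_ne_zero _ (sub_pos.2 hab).ne'), Finset.sum_mul] at h
  rw [← h]
  exact Finset.sum_congr rfl fun c _ => by rw [add_sub_cancel_left, mul_pow]; ring

theorem radauInterp_sub {E : Type*} [AddCommGroup E] [Module ℝ E] (k : ℕ) (a b : ℝ)
    (F G : ℝ → E) (t : ℝ) :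
    radauInterp k a b (fun s => F s - G s) t = radauInterp k a b F t - radauInterp k a b G t := by
  simp only [radauInterp, smul_sub, Finset.sum_sub_distrib]

/-- Compactness of the reference interval makes the Lebesgue constant finite; it depends on `k`
alone, hence is the same for all time intervals. -/
theorem exists_lebesgueConst (k : ℕ) : ∃ Λ : ℝ, 0 ≤ Λ ∧ ∀ s ∈ Icc (0 : ℝ) 1,
    ∑ c ∈ radauNodes k, |(Lagrange.basis (radauNodes k) id c).eval s| ≤ Λ := by
  have hc : Continuous fun s : ℝ =>
      ∑ c ∈ radauNodes k, |(Lagrange.basis (radauNodes k) id c).eval s| :=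
    continuous_finsetSum _ fun c _ => (Polynomial.continuous _).abs
  obtain ⟨Λ, hΛ⟩ := (isCompact_Icc (a := (0 : ℝ)) (b := 1)).bddAbove_image hc.continuousOn
  refine ⟨Λ, ?_, fun s hs => hΛ ⟨s, hs, rfl⟩⟩
  exact (Finset.sum_nonneg fun c _ => abs_nonneg _).trans
    (hΛ ⟨0, left_mem_Icc.2 zero_le_one, rfl⟩)

theorem norm_radauInterp_le {E : Type*} [NormedAddCommGroup E] [NormedSpace ℝ E] {k : ℕ}
    {a b Λ ε : ℝ} (hab : a < b) (hΛ : ∀ s ∈ Icc (0 : ℝ) 1,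
      ∑ c ∈ radauNodes k, |(Lagrange.basis (radauNodes k) id c).eval s| ≤ Λ) (hε : 0 ≤ ε)
    {F : ℝ → E} (hF : ∀ t ∈ Icc a b, ‖F t‖ ≤ ε) {t : ℝ} (ht : t ∈ Icc a b) :
    ‖radauInterp k a b F t‖ ≤ Λ * ε := by
  have hba := sub_pos.2 hab
  refine (norm_sum_le _ _).trans ?_
  have hs : (t - a) / (b - a) ∈ Icc (0 : ℝ) 1 :=
    ⟨div_nonneg (sub_nonneg.2 ht.1) hba.le, (div_le_one hba).2 (sub_le_sub_right ht.2 _)⟩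
  refine le_trans ?_ (mul_le_mul_of_nonneg_right (hΛ _ hs) hε)
  rw [Finset.sum_mul]
  refine Finset.sum_le_sum fun c hc => ?_
  rw [norm_smul, Real.norm_eq_abs]
  exact mul_le_mul_of_nonneg_left (hF _ (Ioc_subset_Icc_self (radauNode_mem_Ioc hab hc)))
    (abs_nonneg _)

/-- The interpolation error for a function with a bounded derivative of order `k + 1`. -/
theorem norm_sub_radauInterp_le {E : Type*} [NormedAddCommGroup E] [NormedSpace ℝ E] {k : ℕ}
    {a b Λ K : ℝ} (hab : a < b) (hΛ : ∀ s ∈ Icc (0 : ℝ) 1,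
      ∑ c ∈ radauNodes k, |(Lagrange.basis (radauNodes k) id c).eval s| ≤ Λ)
    {f : ℝ → E} (hf : ContDiff ℝ (k + 1) f)
    (hK : ∀ t ∈ Icc a b, ‖iteratedDeriv (k + 1) f t‖ ≤ K) {t : ℝ} (ht : t ∈ Icc a b) :
    ‖f t - radauInterp k a b f t‖ ≤ (1 + Λ) * (K * (b - a) ^ (k + 1)) := by
  have hK0 : 0 ≤ K := (norm_nonneg _).trans (hK a (left_mem_Icc.2 hab.le))
  have hba := sub_pos.2 hab
  -- `P` is the Taylor polynomial at `a`. Interpolation reproduces it, so the error for `f` is that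
  -- for `f - P`: the Taylor remainder accounts for the `1` and its interpolant for the `Λ` in `1 +
  -- Λ`.
  set P : ℝ → E := fun t => ∑ i ∈ Finset.range (k + 1),
    (t - a) ^ i • ((i.factorial : ℝ)⁻¹ • iteratedDerivWithin i f (Icc a b) a) with hP
  have hT : ∀ s ∈ Icc a b, ‖f s - P s‖ ≤ K * (b - a) ^ (k + 1) := by
    intro s hs
    have h := taylor_mean_remainder_bound (f := f) (n := k) (C := K) hab.le
      hf.contDiffOn hs (fun y hy => by
        rw [iteratedDerivWithin_eq_iteratedDeriv (uniqueDiffOn_Icc hab)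
          (by exact_mod_cast hf.contDiffAt) hy]
        exact hK y hy)
    rw [taylor_within_apply] at h
    have he : P s = ∑ i ∈ Finset.range (k + 1),
        ((i.factorial : ℝ)⁻¹ * (s - a) ^ i) • iteratedDerivWithin i f (Icc a b) a :=
      Finset.sum_congr rfl fun i _ => by rw [smul_smul, mul_comm]
    rw [he]
    refine h.trans ((div_le_self (mul_nonneg hK0 (pow_nonneg (sub_nonneg.2 hs.1) _))
      (by exact_mod_cast Nat.one_le_iff_ne_zero.2 k.factorial_ne_zero)).trans ?_)
    exact mul_le_mul_of_nonneg_left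
      (pow_le_pow_left₀ (sub_nonneg.2 hs.1) (sub_le_sub_right hs.2 _) _) hK0
  have hrep : radauInterp k a b P t = P t := radauInterp_shifted_poly hab _ t
  have hsplit : f t - radauInterp k a b f t =
      (f t - P t) - radauInterp k a b (fun s => f s - P s) t := by
    rw [radauInterp_sub, hrep]; abel
  rw [hsplit, add_mul, one_mul]
  exact (norm_sub_le _ _).trans (add_le_add (hT t ht) (norm_radauInterp_le hab hΛ
    (mul_nonneg hK0 (pow_nonneg hba.le _)) hT ht))

/-- The rule integrates the product of an interpolant and a polynomial of degree `k` exactly. -/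
theorem integral_inner_radauInterp {H : Type*} [NormedAddCommGroup H] [InnerProductSpace ℝ H]
    {k : ℕ} {a b : ℝ} (hab : a < b) (F g : ℝ → H) (e : Fin (k + 1) → H)
    (hg : ∀ t ∈ Ioc a b, g t = ∑ j : Fin (k + 1), t ^ (j : ℕ) • e j) :
    ∫ t in a..b, inner ℝ (radauInterp k a b F t) (g t) =
      radauQuad k a b fun t => inner ℝ (F t) (g t) := by
  have hba := sub_pos.2 hab
  -- The integrand pulled back to the unit interval. The vectors enter only through the scalars `⟪F
  -- (node), e j⟫`, which leaves a real polynomial of degree at most `k + k`.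
  set q : Polynomial ℝ := ∑ c ∈ radauNodes k, ∑ j : Fin (k + 1),
    Lagrange.basis (radauNodes k) id c *
      (Polynomial.C a + Polynomial.C (b - a) * Polynomial.X) ^ (j : ℕ) *
      Polynomial.C (inner ℝ (F (a + (b - a) * c)) (e j)) with hq
  have hqd : q.natDegree ≤ 2 * k := by
    refine Polynomial.natDegree_sum_le_of_forall_le _ _ fun c hc =>
      Polynomial.natDegree_sum_le_of_forall_le _ _ fun j _ => ?_
    have h1 : (Lagrange.basis (radauNodes k) id c).natDegree = k := by
      apply Polynomial.natDegree_eq_of_degree_eq_some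
      rw [Lagrange.degree_basis Function.injective_id.injOn hc, card_radauNodes]
      simp
    have h2 : (Polynomial.C a + Polynomial.C (b - a) * Polynomial.X).natDegree ≤ 1 := by
      rw [add_comm]; exact Polynomial.natDegree_linear_le
    have h3 := Polynomial.natDegree_pow_le_of_le (j : ℕ) h2
    have h4 := Polynomial.natDegree_mul_le (p := Lagrange.basis (radauNodes k) id c)
      (q := (Polynomial.C a + Polynomial.C (b - a) * Polynomial.X) ^ (j : ℕ))
    have h5 := j.2
    refine (Polynomial.natDegree_mul_C_le _ _).trans ?_
    omega
  have hqe : ∀ s ∈ Ioc (0 : ℝ) 1,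
      inner ℝ (radauInterp k a b F (a + (b - a) * s)) (g (a + (b - a) * s)) = q.eval s := by
    intro s hs
    have hmem : a + (b - a) * s ∈ Ioc a b := by
      constructor <;> nlinarith [mul_pos hba hs.1, hs.2]
    have hs' : (a + (b - a) * s - a) / (b - a) = s := by
      field_simp [hba.ne']; ring
    rw [hg _ hmem, radauInterp, hs', sum_inner, hq, Polynomial.eval_finsetSum]
    refine Finset.sum_congr rfl fun c _ => ?_
    rw [inner_sum, Polynomial.eval_finsetSum]
    refine Finset.sum_congr rfl fun j _ => ?_
    rw [real_inner_smul_left, real_inner_smul_right]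
    simp only [Polynomial.eval_mul, Polynomial.eval_pow, Polynomial.eval_add, Polynomial.eval_C,
      Polynomial.eval_X]
    ring
  have hcv := intervalIntegral.integral_comp_add_mul (a := (0 : ℝ)) (b := 1)
    (fun t => inner ℝ (radauInterp k a b F t) (g t)) hba.ne' a
  rw [mul_zero, mul_one, add_zero, add_sub_cancel, smul_eq_mul] at hcv
  have hint : ∫ s in (0 : ℝ)..1,
      inner ℝ (radauInterp k a b F (a + (b - a) * s)) (g (a + (b - a) * s)) =
        ∫ s in (0 : ℝ)..1, q.eval s := by
    refine intervalIntegral.integral_congr_ae (Filter.Eventually.of_forall fun s hs => ?_)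
    rw [uIoc_of_le zero_le_one] at hs
    exact hqe s hs
  rw [hint, ← radau_exact k q hqd, eq_inv_mul_iff_mul_eq₀ hba.ne'] at hcv
  rw [← hcv, radauQuad]
  congr 1
  refine Finset.sum_congr rfl fun c hc => ?_
  rw [← hqe c (radauNodes_subset k hc), radauInterp_node hab F hc]

/-- A bound for the quadrature defect of `t ↦ ⟪F t, g t⟫` in terms of the interpolation error. -/
theorem abs_integral_sub_radauQuad_le {H : Type*} [NormedAddCommGroup H] [InnerProductSpace ℝ H]
    {k : ℕ} {a b ε : ℝ} (hab : a < b) {F g : ℝ → H} (e : Fin (k + 1) → H)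
    (hg : ∀ t ∈ Ioc a b, g t = ∑ j : Fin (k + 1), t ^ (j : ℕ) • e j)
    (hF : ContinuousOn F (Icc a b))
    (hε : ∀ t ∈ Icc a b, ‖F t - radauInterp k a b F t‖ ≤ ε) :
    |(∫ t in a..b, inner ℝ (F t) (g t)) - radauQuad k a b fun t => inner ℝ (F t) (g t)| ≤
      ε * ∫ t in a..b, ‖g t‖ := by
  -- The polynomial form of `g` is known only on `(a, b]`; its extension `g'` supplies continuity,
  -- and the missing point `a` is null.
  set g' : ℝ → H := fun t => ∑ j : Fin (k + 1), t ^ (j : ℕ) • e j with hg'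
  have hgc : Continuous g' :=
    continuous_finsetSum _ fun j _ => (continuous_pow _).smul continuous_const
  have hcongr : ∀ G : ℝ → H, ∫ t in a..b, inner ℝ (G t) (g t) =
      ∫ t in a..b, inner ℝ (G t) (g' t) := fun G => by
    refine intervalIntegral.integral_congr_ae (Filter.Eventually.of_forall fun t ht => ?_)
    rw [uIoc_of_le hab.le] at ht
    rw [hg t ht]
  have hn : ∫ t in a..b, ‖g t‖ = ∫ t in a..b, ‖g' t‖ := by
    refine intervalIntegral.integral_congr_ae (Filter.Eventually.of_forall fun t ht => ?_)
    rw [uIoc_of_le hab.le] at ht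
    rw [hg t ht]
  rw [← integral_inner_radauInterp hab F g e hg, hcongr, hcongr, hn,
    ← intervalIntegral.integral_sub, ← intervalIntegral.integral_const_mul, ← Real.norm_eq_abs]
  · refine intervalIntegral.norm_integral_le_of_norm_le hab.le
      (Filter.Eventually.of_forall fun t ht => ?_)
      ((continuous_const.mul hgc.norm).intervalIntegrable _ _)
    rw [← inner_sub_left]
    exact (norm_inner_le_norm _ _).trans
      (mul_le_mul_of_nonneg_right (hε t (Ioc_subset_Icc_self ht)) (norm_nonneg _))
  · refine ContinuousOn.intervalIntegrable ?_
    rw [uIcc_of_le hab.le]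
    exact hF.inner hgc.continuousOn
  · exact ((continuous_radauInterp k a b F).inner hgc).intervalIntegrable _ _

/-! ### Superposition operators along polynomials in time -/

/-- For `j < l` the descending factorial vanishes, so the truncated exponent is harmless. Every
derivative is a combination of the same `u j` with scalar coefficients, a form that passes through
linear maps and from `Lp` classes to point values. -/
theorem iteratedDeriv_sum_pow_smul {E : Type*} [NormedAddCommGroup E] [NormedSpace ℝ E] {m : ℕ}
    (u : Fin m → E) (l : ℕ) (t : ℝ) :
    iteratedDeriv l (fun s : ℝ => ∑ j : Fin m, s ^ (j : ℕ) • u j) t =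
      ∑ j : Fin m, (((j : ℕ).descFactorial l : ℝ) * t ^ ((j : ℕ) - l)) • u j := by
  induction l generalizing t with
  | zero => simp
  | succ l ih =>
    rw [iteratedDeriv_succ, funext ih]
    have h : HasDerivAt (fun s : ℝ => ∑ j : Fin m,
        (((j : ℕ).descFactorial l : ℝ) * s ^ ((j : ℕ) - l)) • u j)
        (∑ j : Fin m, (((j : ℕ).descFactorial l : ℝ) *
          ((((j : ℕ) - l : ℕ) : ℝ) * t ^ ((j : ℕ) - l - 1))) • u j) t :=
      HasDerivAt.fun_sum fun j _ => ((hasDerivAt_pow _ t).const_mul _).smul_const (u j)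
    rw [h.deriv]
    refine Finset.sum_congr rfl fun j _ => ?_
    rw [Nat.descFactorial_succ, Nat.sub_sub, Nat.cast_mul, ← mul_assoc,
      mul_comm (((j : ℕ).descFactorial l : ℕ) : ℝ)]

theorem contDiff_sum_pow_smul {E : Type*} [NormedAddCommGroup E] [NormedSpace ℝ E] {m : ℕ}
    (u : Fin m → E) : ContDiff ℝ ∞ fun s : ℝ => ∑ j : Fin m, s ^ (j : ℕ) • u j :=
  ContDiff.sum fun _ _ => (contDiff_id.pow _).smul contDiff_const

/-- The derivatives of `Φ ∘ γ` are bounded in terms of `Φ` and of bounds for those of `γ`. -/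
theorem exists_bound_iteratedDeriv_comp {E E' : Type*} [NormedAddCommGroup E] [NormedSpace ℝ E]
    [FiniteDimensional ℝ E] [NormedAddCommGroup E'] [NormedSpace ℝ E'] {Φ : E → E'}
    (hΦ : ContDiff ℝ ∞ Φ) (A : ℝ) (m : ℕ) :
    ∃ K : ℝ, 0 ≤ K ∧ ∀ (γ : ℝ → E), ContDiff ℝ ∞ γ → ∀ t : ℝ,
      (∀ l ≤ m, ‖iteratedDeriv l γ t‖ ≤ A) → ∀ n ≤ m, ‖iteratedDeriv n (Φ ∘ γ) t‖ ≤ K := by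
  have hc : Continuous fun y => ∑ i ∈ Finset.range (m + 1), ‖iteratedFDeriv ℝ i Φ y‖ :=
    continuous_finsetSum _ fun i _ =>
      (hΦ.continuous_iteratedFDeriv (by exact_mod_cast le_top)).norm
  -- Finite dimension makes the ball compact, so the derivatives of `Φ` of order at most `m` are
  -- bounded where `γ` takes its values.
  obtain ⟨C, hC⟩ := (isCompact_closedBall (0 : E) A).bddAbove_image hc.continuousOn
  have hD : (1 : ℝ) ≤ max 1 A := le_max_left _ _
  -- The bound `n! * C * D ^ n` for compositions asks for `D ^ i` as the bound of the `i`-th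
  -- derivative of `γ`; taking `D = max 1 A` ensures `A ≤ D ^ i` for `i ≥ 1`.
  refine ⟨m.factorial * max C 0 * max 1 A ^ m, by positivity, fun γ hγ t hb n hn => ?_⟩
  rw [← norm_iteratedFDeriv_eq_norm_iteratedDeriv]
  have hmem : γ t ∈ Metric.closedBall (0 : E) A := by
    simpa using hb 0 (Nat.zero_le _)
  refine (norm_iteratedFDeriv_comp_le hΦ hγ (n := n) (by exact_mod_cast le_top) t
    (C := max C 0) (D := max 1 A) (fun i hi => ?_) (fun i h1 hi => ?_)).trans ?_
  · refine le_trans ?_ ((hC ⟨γ t, hmem, rfl⟩).trans (le_max_left _ _))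
    exact Finset.single_le_sum (f := fun i => ‖iteratedFDeriv ℝ i Φ (γ t)‖)
      (fun i _ => norm_nonneg _) (Finset.mem_range.2 (by omega))
  · rw [norm_iteratedFDeriv_eq_norm_iteratedDeriv]
    exact ((hb i (hi.trans hn)).trans (le_max_right _ _)).trans
      (le_self_pow₀ hD (by omega))
  · have h1 : (n.factorial : ℝ) ≤ m.factorial := by exact_mod_cast Nat.factorial_le hn
    have h2 := pow_le_pow_right₀ hD hn
    gcongr

theorem coeFn_sum_smul {X E ι : Type*} [MeasurableSpace X] {μ : Measure X}
    [NormedAddCommGroup E] [NormedSpace ℝ E] {p : ℝ≥0∞} (s : Finset ι) (r : ι → ℝ)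
    (U : ι → Lp E p μ) :
    ⇑(∑ j ∈ s, r j • U j : Lp E p μ) =ᵐ[μ] fun x => ∑ j ∈ s, r j • U j x := by
  classical
  induction s using Finset.induction_on with
  | empty =>
    simp only [Finset.sum_empty]
    exact Lp.coeFn_zero E p μ
  | insert i s hi ih =>
    rw [Finset.sum_insert hi]
    filter_upwards [Lp.coeFn_add (r i • U i) (∑ j ∈ s, r j • U j), ih,
      Lp.coeFn_smul (r i) (U i)] with x h1 h2 h3
    rw [h1, Pi.add_apply, h2, h3, Finset.sum_insert hi, Pi.smul_apply]

/-- A bound that holds for almost all times and then for almost all points holds, outside of one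
null set of points, at all times. -/
theorem ae_forall_norm_sum_smul_le {X E ι : Type*} [MeasurableSpace X] {μ : Measure X}
    [NormedAddCommGroup E] [NormedSpace ℝ E] [Fintype ι] {p : ℝ≥0∞} {a b A : ℝ} (hab : a < b)
    {q : ι → ℝ → ℝ} (hq : ∀ j, Continuous (q j)) (U : ι → Lp E p μ)
    (h : ∀ᵐ t ∂volume.restrict (Ioc a b), ∀ᵐ x ∂μ, ‖(∑ j, q j t • U j : Lp E p μ) x‖ ≤ A) :
    ∀ᵐ x ∂μ, ∀ t ∈ Icc a b, ‖∑ j, q j t • U j x‖ ≤ A := by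
  -- The good times have full measure, hence are dense. A countable dense subset of them costs only
  -- one null set of points `x`; for each other `x` the bound extends to all of `[a, b]` by
  -- continuity in `t`.
  set S : Set ℝ := {t | t ∈ Ioc a b → ∀ᵐ x ∂μ, ‖(∑ j, q j t • U j : Lp E p μ) x‖ ≤ A} with hS
  have hdense : Dense S := Measure.dense_of_ae ((ae_restrict_iff' measurableSet_Ioc).1 h)
  have hcl : Icc a b ⊆ closure (Ioo a b ∩ S) := by
    rw [← closure_Ioo hab.ne]
    exact closure_minimal (hdense.open_subset_closure_inter isOpen_Ioo) isClosed_closure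
  obtain ⟨D, hDS, hDc, hDd⟩ := (TopologicalSpace.IsSeparable.of_separableSpace
    (Ioo a b ∩ S)).exists_countable_dense_subset
  have hae : ∀ᵐ x ∂μ, ∀ t ∈ D, ‖∑ j, q j t • U j x‖ ≤ A := by
    rw [ae_ball_iff hDc]
    intro t ht
    filter_upwards [(hDS ht).2 (Ioo_subset_Ioc_self (hDS ht).1),
      coeFn_sum_smul Finset.univ (fun j => q j t) U] with x h1 h2
    rwa [h2] at h1
  filter_upwards [hae] with x hx t ht
  have hclosed : IsClosed {t | ‖∑ j, q j t • U j x‖ ≤ A} :=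
    isClosed_le (continuous_finsetSum _ fun j _ => (hq j).smul continuous_const).norm
      continuous_const
  exact closure_minimal hx hclosed (closure_minimal hDd isClosed_closure (hcl ht))

/-- Time regularity of a superposition operator along a polynomial in time with bounded time
derivatives, as a curve in `L²`. -/
theorem exists_superposition {X E E' : Type*} [MeasurableSpace X] (μ : Measure X)
    [IsFiniteMeasure μ] [NormedAddCommGroup E] [NormedSpace ℝ E] [FiniteDimensional ℝ E]
    [NormedAddCommGroup E'] [NormedSpace ℝ E'] {Φ : E → E'} (hΦ : ContDiff ℝ ∞ Φ) (A : ℝ≥0)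
    (k : ℕ) :
    ∃ C : ℝ, 0 ≤ C ∧ ∀ (a b : ℝ), a < b → ∀ U : Fin (k + 1) → Lp E 2 μ,
      (∀ l ≤ k, ∀ᵐ t ∂volume.restrict (Ioc a b), ∀ᵐ x ∂μ,
        ‖(∑ j : Fin (k + 1), (((j : ℕ).descFactorial l : ℝ) * t ^ ((j : ℕ) - l)) • U j :
          Lp E 2 μ) x‖ ≤ A) →
      ∃ F : ℝ → Lp E' 2 μ,
        (∀ t ∈ Icc a b, F t =ᵐ[μ]
          fun x => Φ ((∑ j : Fin (k + 1), t ^ (j : ℕ) • U j : Lp E 2 μ) x)) ∧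
        ContinuousOn F (Icc a b) ∧
        ∀ t ∈ Icc a b, ‖F t - radauInterp k a b F t‖ ≤ C * (b - a) ^ (k + 1) := by
  obtain ⟨K, hK0, hK⟩ := exists_bound_iteratedDeriv_comp hΦ A (k + 1)
  obtain ⟨Λ, hΛ0, hΛ⟩ := exists_lebesgueConst k
  -- The square root of the total mass, the price of passing from a uniform bound to the `L²` norm.
  set m : ℝ := (measureUnivNNReal μ : ℝ) ^ (2 : ℝ≥0∞).toReal⁻¹ with hm
  have hm0 : 0 ≤ m := by positivity
  refine ⟨m * ((1 + Λ) * K), by positivity, fun a b hab U hU => ?_⟩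
  set Γ : X → ℝ → E := fun x s => ∑ j : Fin (k + 1), s ^ (j : ℕ) • U j x with hΓ
  have hΓs : ∀ x, ContDiff ℝ ∞ (Γ x) := fun x => contDiff_sum_pow_smul _
  have hΦΓ : ∀ x, ContDiff ℝ ∞ (Φ ∘ Γ x) := fun x => hΦ.comp (hΓs x)
  have hbd : ∀ᵐ x ∂μ, ∀ t ∈ Icc a b, ∀ n ≤ k + 1, ‖iteratedDeriv n (Φ ∘ Γ x) t‖ ≤ K := by
    have h1 : ∀ᵐ x ∂μ, ∀ l : Fin (k + 1), ∀ t ∈ Icc a b,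
        ‖∑ j : Fin (k + 1), (((j : ℕ).descFactorial l : ℝ) * t ^ ((j : ℕ) - (l : ℕ))) • U j x‖
          ≤ A := by
      rw [ae_all_iff]
      exact fun l => ae_forall_norm_sum_smul_le hab
        (fun j => continuous_const.mul (continuous_pow _)) U (hU l (Nat.lt_succ_iff.1 l.2))
    filter_upwards [h1] with x hx t ht
    refine hK (Γ x) (hΓs x) t fun l hl => ?_
    rw [iteratedDeriv_sum_pow_smul]
    rcases Nat.lt_or_ge l (k + 1) with hlt | hge
    · exact hx ⟨l, hlt⟩ t ht
    -- Order `k + 1`, not covered by the hypothesis: the derivative of a polynomial of degree at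
    -- most `k` is zero.
    · rw [Finset.sum_eq_zero, norm_zero]
      · exact A.2
      · intro j _
        rw [Nat.descFactorial_of_lt (lt_of_lt_of_le j.2 hge), Nat.cast_zero, zero_mul, zero_smul]
  have hcoe : ∀ t, ⇑(∑ j : Fin (k + 1), t ^ (j : ℕ) • U j : Lp E 2 μ) =ᵐ[μ]
      fun x => Γ x t := fun t => coeFn_sum_smul _ _ _
  have hmem : ∀ t ∈ Icc a b, MemLp (fun x => Φ (Γ x t)) 2 μ := by
    intro t ht
    refine MemLp.of_bound ?_ K ?_
    · refine hΦ.continuous.comp_aestronglyMeasurable ?_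
      exact (Lp.aestronglyMeasurable _).congr (hcoe t)
    · filter_upwards [hbd] with x hx
      simpa using hx t ht 0 (Nat.zero_le _)
  -- Outside `[a, b]` there is no bound on `Φ (Γ x t)`, and the curve gets the default value `0`.
  have hex : ∀ t, ∃ f : Lp E' 2 μ, t ∈ Icc a b → f =ᵐ[μ] fun x => Φ (Γ x t) := by
    intro t
    by_cases ht : t ∈ Icc a b
    · exact ⟨(hmem t ht).toLp, fun _ => (hmem t ht).coeFn_toLp⟩
    · exact ⟨0, fun h => absurd h ht⟩
  choose F hF using hex
  refine ⟨F, fun t ht => ?_, ?_, fun t ht => ?_⟩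
  · filter_upwards [hF t ht, hcoe t] with x h1 h2
    rw [h1, h2]
  -- Since `K` also bounds the first derivative for almost every `x`, the mean value inequality
  -- makes the curve Lipschitz in `L²`.
  · have hlip : ∀ s ∈ Icc a b, ∀ t ∈ Icc a b, ‖F t - F s‖ ≤ m * K * ‖t - s‖ := by
      intro s hs t ht
      rw [mul_assoc]
      refine Lp.norm_le_of_ae_bound (by positivity) ?_
      filter_upwards [Lp.coeFn_sub (F t) (F s), hF t ht, hF s hs, hbd] with x h1 h2 h3 h4
      rw [h1, Pi.sub_apply, h2, h3]
      refine (convex_Icc a b).norm_image_sub_le_of_norm_deriv_le (𝕜 := ℝ) (f := Φ ∘ Γ x)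
        (fun y _ => (hΦΓ x).contDiffAt.differentiableAt (by simp)) (fun y hy => ?_) hs ht
      rw [← iteratedDeriv_one]
      exact h4 y hy 1 (by omega)
    refine LipschitzOnWith.continuousOn (K := ⟨m * K, by positivity⟩)
      (LipschitzOnWith.of_dist_le_mul fun t ht s hs => ?_)
    rw [dist_eq_norm, dist_eq_norm]
    exact hlip s hs t ht
  · rw [mul_assoc, mul_assoc]
    refine Lp.norm_le_of_ae_bound
      (mul_nonneg (by positivity) (mul_nonneg hK0 (pow_nonneg (sub_pos.2 hab).le _))) ?_
    have hnodes : ∀ᵐ x ∂μ, ∀ c ∈ radauNodes k,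
        F (a + (b - a) * c) x = Φ (Γ x (a + (b - a) * c)) := by
      refine (ae_ball_iff (radauNodes k).countable_toSet).2 fun c hc => ?_
      exact hF _ (Ioc_subset_Icc_self (radauNode_mem_Ioc hab hc))
    filter_upwards [Lp.coeFn_sub (F t) (radauInterp k a b F t), hF t ht, hbd, hnodes,
      coeFn_sum_smul (radauNodes k) (fun c =>
        (Lagrange.basis (radauNodes k) id c).eval ((t - a) / (b - a)))
        (fun c => F (a + (b - a) * c))] with x h1 h2 h3 h4 h5
    -- Only finitely many node values enter, so interpolation in `Lp` agrees almost everywhere with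
    -- interpolation at fixed `x`.
    have h6 : radauInterp k a b F t x = radauInterp k a b (Φ ∘ Γ x) t := by
      refine h5.trans (Finset.sum_congr rfl fun c hc => ?_)
      rw [h4 c hc]; rfl
    rw [h1, Pi.sub_apply, h2, h6]
    exact norm_sub_radauInterp_le hab hΛ ((hΦΓ x).of_le (by exact_mod_cast le_top))
      (fun s hs => h3 s hs _ le_rfl) ht

/-- The quadrature defect of a form `t ↦ ∫ Φ(u(t)) : g(t)`, where `u` and `g` are polynomials in
time. -/
theorem exists_defect_bound {X E E' : Type*} [MeasurableSpace X] (μ : Measure X)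
    [IsFiniteMeasure μ] [NormedAddCommGroup E] [NormedSpace ℝ E] [FiniteDimensional ℝ E]
    [NormedAddCommGroup E'] [InnerProductSpace ℝ E'] {Φ : E → E'} (hΦ : ContDiff ℝ ∞ Φ)
    (A : ℝ≥0) (k : ℕ) :
    ∃ C : ℝ, 0 ≤ C ∧ ∀ (a b : ℝ), a < b → ∀ (U : Fin (k + 1) → Lp E 2 μ)
      (e : Fin (k + 1) → Lp E' 2 μ) (g : ℝ → Lp E' 2 μ) (φ : ℝ → ℝ),
      (∀ l ≤ k, ∀ᵐ t ∂volume.restrict (Ioc a b), ∀ᵐ x ∂μ,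
        ‖(∑ j : Fin (k + 1), (((j : ℕ).descFactorial l : ℝ) * t ^ ((j : ℕ) - l)) • U j :
          Lp E 2 μ) x‖ ≤ A) →
      (∀ t ∈ Ioc a b, g t = ∑ j : Fin (k + 1), t ^ (j : ℕ) • e j) →
      (∀ t ∈ Ioc a b, φ t = ∫ x,
        inner ℝ (Φ ((∑ j : Fin (k + 1), t ^ (j : ℕ) • U j : Lp E 2 μ) x)) (g t x) ∂μ) →
      |(∫ t in a..b, φ t) - radauQuad k a b φ| ≤
        C * (b - a) ^ (k + 1) * ∫ t in a..b, ‖g t‖ := by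
  obtain ⟨C, hC0, hC⟩ := exists_superposition μ hΦ A k
  refine ⟨C, hC0, fun a b hab U e g φ hU hg hφ => ?_⟩
  obtain ⟨F, hF, hFc, hFi⟩ := hC a b hab U hU
  have hφF : ∀ t ∈ Ioc a b, φ t = inner ℝ (F t) (g t) := by
    intro t ht
    rw [hφ t ht, L2.inner_def]
    refine integral_congr_ae ?_
    filter_upwards [hF t (Ioc_subset_Icc_self ht)] with x hx
    rw [hx]
  have h1 : ∫ t in a..b, φ t = ∫ t in a..b, inner ℝ (F t) (g t) := by
    refine intervalIntegral.integral_congr_ae (Filter.Eventually.of_forall fun t ht => ?_)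
    rw [uIoc_of_le hab.le] at ht
    exact hφF t ht
  have h2 : radauQuad k a b φ = radauQuad k a b fun t => inner ℝ (F t) (g t) := by
    rw [radauQuad, radauQuad]
    congr 1
    exact Finset.sum_congr rfl fun c hc => by rw [hφF _ (radauNode_mem_Ioc hab hc)]
  rw [h1, h2]
  exact abs_integral_sub_radauQuad_le hab e hg hFc hFi

/-! ### The convective and the viscous form -/

theorem contDiff_outer_self (d : ℕ) : ContDiff ℝ ∞ fun y : Vec d => outer y y := by
  rw [contDiff_euclidean]
  intro ij
  exact (contDiff_euclidean.1 contDiff_id ij.1).mul (contDiff_euclidean.1 contDiff_id ij.2)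

theorem contDiff_symPart (d : ℕ) : ContDiff ℝ ∞ (symPart : Mat d → Mat d) := by
  rw [contDiff_euclidean]
  intro ij
  exact ((contDiff_euclidean.1 contDiff_id ij).add
    (contDiff_euclidean.1 contDiff_id ij.swap)).div_const _

/-- With `δ > 0` the base of the power stays positive, also at the zero matrix, and `‖y‖ ^ 2` is
smooth there. -/
theorem contDiff_stress (d : ℕ) (p νinf ν : ℝ) {δ : ℝ} (hδ : 0 < δ) :
    ContDiff ℝ ∞ (stress p νinf ν δ : Mat d → Mat d) := by
  have h : ContDiff ℝ ∞ fun y : Mat d => (δ ^ 2 + ‖y‖ ^ 2) ^ ((p - 2) / 2) :=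
    (contDiff_const.add (contDiff_norm_sq ℝ)).rpow_const_of_ne fun y => by positivity
  exact (contDiff_const.add (contDiff_const.mul h)).smul contDiff_id

/-- Transposition permutes the index pairs and is its own inverse, so it is self-adjoint for the
Frobenius product. -/
theorem inner_symPart_right {d : ℕ} (A B : Mat d) :
    inner ℝ A (symPart B) = inner ℝ (symPart A) B := by
  have h : ∑ ij : Fin d × Fin d, B ij.swap * A ij = ∑ ij : Fin d × Fin d, B ij * A ij.swap :=
    Fintype.sum_equiv (Equiv.prodComm _ _) _ _ fun ij => by simp
  simp only [PiLp.inner_apply, symPart, RCLike.inner_apply, conj_trivial]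
  have h1 : ∀ ij : Fin d × Fin d, (B ij + B ij.swap) / 2 * A ij =
      (B ij * A ij + B ij.swap * A ij) / 2 := fun ij => by ring
  have h2 : ∀ ij : Fin d × Fin d, B ij * ((A ij + A ij.swap) / 2) =
      (B ij * A ij + B ij * A ij.swap) / 2 := fun ij => by ring
  simp only [h1, h2, ← Finset.sum_div, Finset.sum_add_distrib, h]

/-- With the symmetrization moved off the test function, both forms are tested with the full weak
gradient, which the `H¹` norm controls. -/
theorem viscForm_eq {d : ℕ} {Ω : Set (Vec d)} (p νinf ν δ : ℝ) (v w : SobolevH1 Ω) :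
    viscForm p νinf ν δ v w = ∫ x in Ω,
      inner ℝ (symPart (stress p νinf ν δ (symPart (weakGrad v x)))) (weakGrad w x) := by
  simp only [viscForm, inner_symPart_right]

/-! ### Discrete functions on a time interval -/

/-- `field` as a linear map. -/
noncomputable def fieldLM {d : ℕ} (Ω : Set (Vec d)) :
    SobolevH1 Ω →ₗ[ℝ] Lp (Vec d) 2 (volume.restrict Ω) where
  toFun := field
  map_add' _ _ := rfl
  map_smul' _ _ := rfl

/-- `weakGrad` as a linear map. -/
noncomputable def weakGradLM {d : ℕ} (Ω : Set (Vec d)) :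
    SobolevH1 Ω →ₗ[ℝ] Lp (Mat d) 2 (volume.restrict Ω) where
  toFun := weakGrad
  map_add' _ _ := rfl
  map_smul' _ _ := rfl

theorem norm_weakGrad_le {d : ℕ} {Ω : Set (Vec d)} (u : SobolevH1 Ω) : ‖weakGrad u‖ ≤ ‖u‖ :=
  WithLp.norm_snd_le _ u.1

theorem ae_norm_le_of_eLpNorm_top_le {X E : Type*} [MeasurableSpace X] {μ : Measure X}
    [NormedAddCommGroup E] {f : X → E} {A : ℝ≥0} (h : eLpNorm f ∞ μ ≤ A) :
    ∀ᵐ x ∂μ, ‖f x‖ ≤ A := by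
  rw [eLpNorm_exponent_top] at h
  filter_upwards [enorm_ae_le_eLpNormEssSup f μ] with x hx
  have := hx.trans h
  rw [enorm_eq_nnnorm] at this
  exact_mod_cast this

namespace TimeMesh

variable {T : ℝ} (M : TimeMesh T)

theorem left_lt_right (n : Fin M.N) : M.left n < M.right n :=
  M.strictMono Fin.castSucc_lt_succ

theorem right_sub_left_le_stepSize (n : Fin M.N) : M.right n - M.left n ≤ M.stepSize :=
  le_ciSup (f := fun n : Fin M.N => M.right n - M.left n) (Set.finite_range _).bddAbove n

/-- On the slab, which is a set of unique differentiability, the derivative within it is that of the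
polynomial representing `v`. This turns the norm hypothesis into a bound on explicit combinations of
the coefficients. -/
theorem ae_apply_sum_le {W : Type*} [NormedAddCommGroup W] [NormedSpace ℝ W] (ρ : W → ℝ≥0∞)
    {m l : ℕ} {v : ℝ → W} {n : Fin M.N} {A : ℝ≥0∞}
    (hA : essSup (fun t => ρ (iteratedDerivWithin l v (M.slab n) t))
      (volume.restrict (M.slab n)) ≤ A) (c : Fin m → W)
    (hc : ∀ t ∈ M.slab n, v t = ∑ j : Fin m, t ^ (j : ℕ) • c j) :
    ∀ᵐ t ∂volume.restrict (M.slab n), ρ (∑ j : Fin m,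
      (((j : ℕ).descFactorial l : ℝ) * t ^ ((j : ℕ) - l)) • c j) ≤ A := by
  have hu : UniqueDiffOn ℝ (M.slab n) := uniqueDiffOn_Ioc _ _
  filter_upwards [ENNReal.ae_le_essSup (μ := volume.restrict (M.slab n))
    (fun t => ρ (iteratedDerivWithin l v (M.slab n) t)),
    ae_restrict_mem (show MeasurableSet (M.slab n) from measurableSet_Ioc)] with t h1 h2
  rw [← iteratedDeriv_sum_pow_smul, ← iteratedDerivWithin_eq_iteratedDeriv hu
    ((contDiff_sum_pow_smul c).contDiffAt.of_le (by exact_mod_cast le_top)) h2,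
    ← iteratedDerivWithin_congr hc h2]
  exact h1.trans hA

theorem IsPiecewisePoly.intervalIntegrable_norm_pow {W : Type*} [NormedAddCommGroup W]
    [NormedSpace ℝ W] {M : TimeMesh T} {k : ℕ} {V : Submodule ℝ W} {w : ℝ → W}
    (hw : M.IsPiecewisePoly k V w) (r : ℕ) (n : Fin M.N) :
    IntervalIntegrable (fun t => ‖w t‖ ^ r) volume (M.left n) (M.right n) := by
  obtain ⟨e, he⟩ := hw n
  refine (((contDiff_sum_pow_smul fun j => (e j : W)).continuous.norm.pow r).intervalIntegrable
    _ _).congr ?_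
  intro t ht
  rw [uIoc_of_le (M.left_lt_right n).le] at ht
  simp only [he t ht, Pi.pow_apply]

theorem IsPiecewisePoly.intervalIntegrable_norm {W : Type*} [NormedAddCommGroup W]
    [NormedSpace ℝ W] {M : TimeMesh T} {k : ℕ} {V : Submodule ℝ W} {w : ℝ → W}
    (hw : M.IsPiecewisePoly k V w) (n : Fin M.N) :
    IntervalIntegrable (fun t => ‖w t‖) volume (M.left n) (M.right n) := by
  simpa only [pow_one] using hw.intervalIntegrable_norm_pow 1 n

theorem IsPiecewisePoly.map {W W' : Type*} [AddCommGroup W] [Module ℝ W] [AddCommGroup W']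
    [Module ℝ W'] {M : TimeMesh T} {k : ℕ} {V : Submodule ℝ W} {w : ℝ → W}
    (hw : M.IsPiecewisePoly k V w) (L : W →ₗ[ℝ] W') :
    M.IsPiecewisePoly k (V.map L) fun t => L (w t) := by
  intro n
  obtain ⟨e, he⟩ := hw n
  refine ⟨fun j => ⟨L (e j), Submodule.mem_map_of_mem (e j).2⟩, fun t ht => ?_⟩
  simp only [he t ht, map_sum, map_smul]

/-- The quadrature defect on one time interval, for a form `∫ Φ(L v) : G w` with `L v` bounded by
`ρ v`, in the application the `W^{1,∞}` norm of `v`. -/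
theorem exists_radauDefect_bound {W X E E' : Type*} [NormedAddCommGroup W] [NormedSpace ℝ W]
    [MeasurableSpace X] (μ : Measure X) [IsFiniteMeasure μ]
    [NormedAddCommGroup E] [NormedSpace ℝ E] [FiniteDimensional ℝ E]
    [NormedAddCommGroup E'] [InnerProductSpace ℝ E']
    (ρ : W → ℝ≥0∞) (L : W →ₗ[ℝ] Lp E 2 μ) (hL : ∀ u, eLpNorm (L u) ∞ μ ≤ ρ u)
    (G : W →ₗ[ℝ] Lp E' 2 μ) (hG : ∀ u, ‖G u‖ ≤ ‖u‖)
    {Φ : E → E'} (hΦ : ContDiff ℝ ∞ Φ) (A : ℝ≥0) (k : ℕ) :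
    ∃ C : ℝ, 0 ≤ C ∧ ∀ {T : ℝ} (M : TimeMesh T) (V : Submodule ℝ W) (v w : ℝ → W),
      M.IsPiecewisePoly k V v → M.IsPiecewisePoly k V w →
      (∀ l ≤ k, ∀ n : Fin M.N, essSup (fun t => ρ (iteratedDerivWithin l v (M.slab n) t))
        (volume.restrict (M.slab n)) ≤ A) → ∀ n : Fin M.N,
      |M.radauDefect k (fun t => ∫ x, inner ℝ (Φ (L (v t) x)) (G (w t) x) ∂μ) n| ≤
        C * M.stepSize ^ (k + 1) * ∫ t in M.left n..M.right n, ‖w t‖ := by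
  obtain ⟨C, hC0, hC⟩ := exists_defect_bound μ hΦ A k
  refine ⟨C, hC0, fun {T} M V v w hv hw hA n => ?_⟩
  have hab := M.left_lt_right n
  obtain ⟨c, hc⟩ := hv n
  obtain ⟨e, he⟩ := hw.map G n
  have hu : ∀ t ∈ Ioc (M.left n) (M.right n),
      L (v t) = ∑ j : Fin (k + 1), t ^ (j : ℕ) • L (c j) := by
    intro t ht
    rw [hc t ht, map_sum]
    simp only [map_smul]
  refine (hC _ _ hab (fun j => L (c j)) (fun j => (e j : Lp E' 2 μ))
    (fun t => G (w t)) _ (fun l hl => ?_) he (fun t ht => ?_)).trans ?_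
  · filter_upwards [M.ae_apply_sum_le ρ (hA l hl n) (fun j => (c j : W)) hc] with t ht
    have h := ae_norm_le_of_eLpNorm_top_le ((hL _).trans ht)
    rw [map_sum] at h
    simp only [map_smul] at h
    exact h
  · simp only [← hu t ht]
  · have hh := (sub_pos.2 hab).le
    refine mul_le_mul (mul_le_mul_of_nonneg_left
      (pow_le_pow_left₀ hh (M.right_sub_left_le_stepSize n) _) hC0)
      (intervalIntegral.integral_mono_on hab.le ((hw.map G).intervalIntegrable_norm n)
        (hw.intervalIntegrable_norm n) fun t _ => hG _)
      (intervalIntegral.integral_nonneg hab.le fun t _ => norm_nonneg _)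
      (mul_nonneg hC0 (pow_nonneg (hh.trans (M.right_sub_left_le_stepSize n)) _))

theorem sum_integral_slabs {f : ℝ → ℝ}
    (hf : ∀ n : Fin M.N, IntervalIntegrable f volume (M.left n) (M.right n)) :
    IntervalIntegrable f volume 0 T ∧
      ∑ n, ∫ t in M.left n..M.right n, f t = ∫ t in (0 : ℝ)..T, f t := by
  -- Stated for arbitrary points, so that the induction may drop the last one and lose the condition
  -- that the mesh ends at `T`.
  have key : ∀ (N : ℕ) (s : Fin (N + 1) → ℝ),
      (∀ n : Fin N, IntervalIntegrable f volume (s n.castSucc) (s n.succ)) →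
      IntervalIntegrable f volume (s 0) (s (Fin.last N)) ∧
        ∑ n : Fin N, ∫ t in s n.castSucc..s n.succ, f t = ∫ t in s 0..s (Fin.last N), f t := by
    intro N
    induction N with
    | zero => intro s _; simp
    | succ N ih =>
      intro s hs
      obtain ⟨h1, h2⟩ := ih (fun i => s i.castSucc) fun n => hs n.castSucc
      have h3 := hs (Fin.last N)
      refine ⟨h1.trans h3, ?_⟩
      rw [Fin.sum_univ_castSucc]
      exact (congrArg (· + _) h2).trans (intervalIntegral.integral_add_adjacent_intervals h1 h3)
  have h := key M.N M.t hf
  rwa [M.first, M.last] at h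

end TimeMesh

/-! ### Cauchy-Schwarz in time and the assembled estimate -/

/-- Cauchy-Schwarz against the constant `1`, by expanding `∫ (T f - J)² ≥ 0` with `J = ∫ f`, which
gives `J² ≤ T ∫ f²`. -/
theorem integral_le_sqrt_mul_sqrt_integral_sq {T : ℝ} (hT : 0 < T) {f : ℝ → ℝ}
    (hf : IntervalIntegrable f volume 0 T)
    (hf2 : IntervalIntegrable (fun t => f t ^ 2) volume 0 T) :
    ∫ t in (0 : ℝ)..T, f t ≤ Real.sqrt T * Real.sqrt (∫ t in (0 : ℝ)..T, f t ^ 2) := by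
  set J := ∫ t in (0 : ℝ)..T, f t with hJ
  have h0 : 0 ≤ ∫ t in (0 : ℝ)..T, (T * f t - J) ^ 2 :=
    intervalIntegral.integral_nonneg hT.le fun t _ => sq_nonneg _
  have h1 : ∫ t in (0 : ℝ)..T, (T * f t - J) ^ 2 =
      T ^ 2 * (∫ t in (0 : ℝ)..T, f t ^ 2) - 2 * T * J * J + T * J ^ 2 := by
    have he : ∀ t, (T * f t - J) ^ 2 = T ^ 2 * f t ^ 2 - 2 * T * J * f t + J ^ 2 :=
      fun t => by ring
    simp only [he]
    rw [intervalIntegral.integral_add ((hf2.const_mul _).sub (hf.const_mul _))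
      intervalIntegrable_const, intervalIntegral.integral_sub (hf2.const_mul _) (hf.const_mul _),
      intervalIntegral.integral_const_mul, intervalIntegral.integral_const_mul,
      intervalIntegral.integral_const, smul_eq_mul, sub_zero]
  rw [← Real.sqrt_mul hT.le]
  refine Real.le_sqrt_of_sq_le ?_
  have h2 : 0 ≤ T * (T * (∫ t in (0 : ℝ)..T, f t ^ 2) - J ^ 2) := by
    rw [h1] at h0
    linarith
  have := nonneg_of_mul_nonneg_right h2 hT
  linarith

theorem mainTheorem2 (d : ℕ) (Ω : Set (Vec d)) (hΩ : IsOpen Ω) (hΩb : Bornology.IsBounded Ω)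
    (T : ℝ) (hT : 0 < T) (k : ℕ) (p νinf ν δ : ℝ) (hp1 : 1 < p) (hp2 : p < 2)
    (hνinf : 0 ≤ νinf) (hν : 0 < ν) (hδ : 0 < δ) (A : ℝ≥0) :
    ∃ B : ℝ, ∀ (M : TimeMesh T) (V : Submodule ℝ (SobolevH1 Ω)) (v w : ℝ → SobolevH1 Ω),
      M.IsPiecewisePoly k V v → M.IsPiecewisePoly k V w →
      (∀ l ≤ k, ∀ n : Fin M.N, M.slabNorm v l n ≤ A) →
      |∑ n, M.radauDefect k (fun t => convForm (v t) (w t)) n| +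
          |∑ n, M.radauDefect k (fun t => viscForm p νinf ν δ (v t) (w t)) n| ≤
        B * M.stepSize ^ (k + 1) * Real.sqrt (∫ t in (0 : ℝ)..T, ‖w t‖ ^ 2) := by
  have hfin : IsFiniteMeasure (volume.restrict Ω) := ⟨by
    rw [Measure.restrict_apply_univ]; exact hΩb.measure_lt_top⟩
  obtain ⟨C₁, hC₁, h₁⟩ := TimeMesh.exists_radauDefect_bound (volume.restrict Ω) w1inftyNorm
    (fieldLM Ω) (fun u => le_max_left _ _) (weakGradLM Ω) norm_weakGrad_le (contDiff_outer_self d) A k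
  obtain ⟨C₂, hC₂, h₂⟩ := TimeMesh.exists_radauDefect_bound (volume.restrict Ω) w1inftyNorm
    (weakGradLM Ω) (fun u => le_max_right _ _) (weakGradLM Ω) norm_weakGrad_le
    (Φ := fun Y => symPart (stress p νinf ν δ (symPart Y)))
    ((contDiff_symPart d).comp ((contDiff_stress d p νinf ν hδ).comp (contDiff_symPart d))) A k
  -- `C₁` and `C₂` are fixed before the mesh, the space and the functions; `√T` comes from
  -- Cauchy-Schwarz in time.
  refine ⟨(C₁ + C₂) * Real.sqrt T, fun M V v w hv hw hA => ?_⟩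
  obtain ⟨hi1, hs1⟩ := M.sum_integral_slabs hw.intervalIntegrable_norm
  obtain ⟨hi2, -⟩ := M.sum_integral_slabs (hw.intervalIntegrable_norm_pow 2)
  have hcs := integral_le_sqrt_mul_sqrt_integral_sq hT hi1 hi2
  have hτ : 0 ≤ M.stepSize := Real.iSup_nonneg fun n => (sub_pos.2 (M.left_lt_right n)).le
  have hsum : ∀ (C : ℝ) (φ : ℝ → ℝ), 0 ≤ C → (∀ n, |M.radauDefect k φ n| ≤
      C * M.stepSize ^ (k + 1) * ∫ t in M.left n..M.right n, ‖w t‖) →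
      |∑ n, M.radauDefect k φ n| ≤ C * M.stepSize ^ (k + 1) *
        (Real.sqrt T * Real.sqrt (∫ t in (0 : ℝ)..T, ‖w t‖ ^ 2)) := by
    intro C φ hC hφ
    refine (Finset.abs_sum_le_sum_abs _ _).trans ((Finset.sum_le_sum fun n _ => hφ n).trans ?_)
    rw [← Finset.mul_sum, hs1]
    exact mul_le_mul_of_nonneg_left hcs (mul_nonneg hC (pow_nonneg hτ _))
  have hconv := hsum C₁ (fun t => convForm (v t) (w t)) hC₁ (h₁ M V v w hv hw hA)
  have hvisc := hsum C₂ (fun t => viscForm p νinf ν δ (v t) (w t)) hC₂ (by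
    simp only [viscForm_eq]
    exact h₂ M V v w hv hw hA)
  refine (add_le_add hconv hvisc).trans (le_of_eq ?_)
  ring
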